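/- Let $V$, $E$, $X$ be finite sets of vertices, internal edges and external edges of an undirected graph, where each internal edge joins two distinct vertices (parallel internal edges are permitted) and each external edge is attached to one vertex; put $n=|X|$. Let $a\ge 1$ be an integer (the physical dimension, carried by every external edge), let $b_e\ge 1$ be integers (the bond dimensions of the internal edges $e\in E$) and $d_i\ge 1$ integers (the logical dimensions of the vertices $i\in V$). A random tensor network (RTN) with these data is given by a unit vector $|0\rangle_i\in\mathcal H_i=\bigotimes_{x\text{ at }i}\mathbb C^a\otimes\mathbb C^{d_i}\otimes\bigotimes_{e\ni i}\mathbb C^{b_e}$ for each vertex $i$ and a unit bulk vector $|\Phi\rangle\in\bigotimes_{i\in V}\mathbb C^{d_i}$. Its random state vector is $$|\psi\rangle=\langle\Phi|\bigotimes_{e\in E}\Big(\sum_{m=1}^{b_e}\langle m\,m|_e\Big)\bigotimes_{i\in V}U_i|0\rangle_i\in(\mathbb C^a)^{\otimes X},$$ with independent Haar-random unitaries $U_i$ on $\mathcal H_i$. With respect to a unit boundary reference vector $|\phi\rangle\in(\mathbb C^a)^{\otimes X}$ its inverse effective dimension is $$\frac1{D_{\rm eff}}=a^n\,\frac{\mathbb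 E\big[|\langle\psi|\phi\rangle|^4\big]}{\big(\mathbb E[\langle\psi|\psi\rangle]\big)^2}.$$ Finally let $$Z=Z_{\log\sqrt b}=e^{-\sum_{e} J_e}\sum_{\sigma\in\{-1,1\}^V}\exp\Big(\sum_{e=\langle i,j\rangle\in E}J_e\,\sigma_i\sigma_j\Big),\qquad J_e=\log\sqrt{b_e}.$$ Suppose that the bulk vector $|\Phi\rangle=\bigotimes_{i}|\Phi_i\rangle$ and the boundary vector $|\phi\rangle=\bigotimes_{x}|\phi_x\rangle$ of every RTN below are unentangled, i.e. tensor products of unit vectors. Then the following holds for fixed graph, $a$ and $(b_e)$. (1) If two families of logical dimensions $d$ and $d'$ agree except at one vertex $k$, where $d_k<d'_k$, then $1/D_{\rm eff}<1/D_{\rm eff}'$ for any RTNs with these logical dimensions (whatever the vectors $|0\rangle_i$ and the unentangled $|\Phi\rangle$, $|\phi\rangle$ in each of them). (2) If the logical dimensions $d_i$ of all vertices tend to infinity, then $1/D_{\rm eff}\to Z/a^n$ (along every sequence of such RTNs). -/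

import Mathlib

open MeasureTheory Filter Topology

noncomputable section

/-! ## Haar measure on the unitary group -/

instance unitaryGroupMeasurableSpace (κ : Type*) [Fintype κ] [DecidableEq κ] :
    MeasurableSpace (Matrix.unitaryGroup κ ℂ) := borel _

instance unitaryGroupBorelSpace (κ : Type*) [Fintype κ] [DecidableEq κ] :
    BorelSpace (Matrix.unitaryGroup κ ℂ) := ⟨rfl⟩

instance unitaryGroupCompactSpace (κ : Type*) [Fintype κ] [DecidableEq κ] :
    CompactSpace (Matrix.unitaryGroup κ ℂ) := by
  have hK : IsCompact (Set.pi Set.univ (fun _ : κ => Set.pi Set.univ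
      (fun _ : κ => Metric.closedBall (0 : ℂ) 1))) :=
    isCompact_univ_pi fun _ => isCompact_univ_pi fun _ => isCompact_closedBall 0 1
  refine isCompact_iff_compactSpace.mp (IsCompact.of_isClosed_subset
    (s := (Set.pi Set.univ (fun _ : κ => Set.pi Set.univ
      (fun _ : κ => Metric.closedBall (0 : ℂ) 1)) : Set (Matrix κ κ ℂ))) hK ?_ ?_)
  · have h : ((Matrix.unitaryGroup κ ℂ : Submonoid (Matrix κ κ ℂ)) : Set (Matrix κ κ ℂ))
        = {A | star A * A = 1} := by
      ext A
      exact Matrix.mem_unitaryGroup_iff'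
    rw [h]
    exact isClosed_eq (by fun_prop) continuous_const
  · intro A hA i _ j _
    simpa using entry_norm_bound_of_unitary hA i j

/-- The Haar measure of the unitary group `U(κ)`, normalized to total mass `1`. -/
def unitaryHaar (κ : Type*) [Fintype κ] [DecidableEq κ] :
    Measure (Matrix.unitaryGroup κ ℂ) :=
  Measure.haarMeasure ⊤

/-! ## Graphs -/

/-- The graph of a tensor network: a vertex for each tensor, a set `E` of internal edges, each of
them joining two distinct vertices, and a set `X` of external edges (physical sites), each of them
attached to one vertex. Several internal edges may join the same two vertices. -/
structure TNGraph (V E X : Type*) where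
  /-- the two end points of an internal edge -/
  ends : E → Sym2 V
  /-- the end points of an internal edge are distinct -/
  not_isDiag : ∀ e, ¬ (ends e).IsDiag
  /-- the vertex to which an external edge is attached -/
  site : X → V

section Network

variable {V E X : Type*} [Fintype V] [Fintype E] [Fintype X]
  [DecidableEq V] [DecidableEq E] [DecidableEq X]

/-- Index set of the standard basis of the Hilbert space of the tensor on vertex `i`, that is of
`(ℂ^a)^{⊗ external edges at i} ⊗ ℂ^(d i) ⊗ ⨂_{internal edges e at i} ℂ^(b e)`.
Its cardinality is the total dimension `q i` of the tensor. -/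
abbrev LegIndex (G : TNGraph V E X) (a : ℕ) (b : E → ℕ) (d : V → ℕ) (i : V) : Type _ :=
  ({x : X // G.site x = i} → Fin a) × Fin (d i) × (∀ e : {e : E // i ∈ G.ends e}, Fin (b e))

/-- The bulk Hilbert space `⨂_i ℂ^(d i)`. -/
abbrev BulkSpace (d : V → ℕ) : Type _ := EuclideanSpace ℂ (∀ i : V, Fin (d i))

/-- The boundary Hilbert space `(ℂ^a)^{⊗ X}`. -/
abbrev BoundarySpace (X : Type*) (a : ℕ) : Type _ := EuclideanSpace ℂ (X → Fin a)

/-- The deterministic data of a random tensor network on `G` with physical dimension `a`, bond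
dimensions `b` and logical dimensions `d`: the reference state vector on which the random unitary of
each vertex acts, and the bulk state vector `Φ`. -/
structure RTN (G : TNGraph V E X) (a : ℕ) (b : E → ℕ) (d : V → ℕ) where
  /-- the reference state vector of each vertex -/
  ref : ∀ i, EuclideanSpace ℂ (LegIndex G a b d i)
  norm_ref : ∀ i, ‖ref i‖ = 1
  /-- the bulk state vector `Φ` -/
  bulk : BulkSpace d
  norm_bulk : ‖bulk‖ = 1

/-- A choice of one unitary for each vertex. -/
abbrev UnitarySample (G : TNGraph V E X) (a : ℕ) (b : E → ℕ) (d : V → ℕ) : Type _ :=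
  ∀ i, Matrix.unitaryGroup (LegIndex G a b d i) ℂ

/-- The law of the unitaries: independent and Haar-distributed. -/
def sampleLaw (G : TNGraph V E X) (a : ℕ) (b : E → ℕ) (d : V → ℕ) :
    Measure (UnitarySample G a b d) :=
  Measure.pi fun i => unitaryHaar (LegIndex G a b d i)

namespace RTN

variable {G : TNGraph V E X} {a : ℕ} {b : E → ℕ} {d : V → ℕ}

/-- The tensor `ψ_i = U_i |0⟩` on vertex `i`, in the standard basis. -/
def tensor (R : RTN G a b d) (U : UnitarySample G a b d) (i : V) : LegIndex G a b d i → ℂ :=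
  ((U i : Matrix (LegIndex G a b d i) (LegIndex G a b d i) ℂ)).mulVec (R.ref i)

/-- The tensor network state vector `ψ = ⟨Φ| ⨂_e ⟨χ_e| ⨂_i |ψ_i⟩` in the boundary Hilbert space:
every internal edge `e` is contracted with `∑_m ⟨m m|`, and the logical legs are projected onto the
bulk state vector `Φ`. -/
def state (R : RTN G a b d) (U : UnitarySample G a b d) : BoundarySpace X a :=
  WithLp.toLp 2 fun s =>
    ∑ t : (∀ i, Fin (d i)), ∑ m : (∀ e, Fin (b e)),
      star (R.bulk t) * ∏ i, R.tensor U i (fun x => s x, t i, fun e => m e)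

/-- The inverse effective dimension
`1 / D_eff = a ^ n * 𝔼[|⟨ψ|φ⟩| ^ 4] / (𝔼[⟨ψ|ψ⟩]) ^ 2`
of the random tensor network with respect to the boundary reference state vector `φ`. -/
def invEffDim (R : RTN G a b d) (φ : BoundarySpace X a) : ℝ :=
  (a : ℝ) ^ Fintype.card X *
    (∫ U, ‖inner ℂ (R.state U) φ‖ ^ 4 ∂(sampleLaw G a b d)) /
      (∫ U, ‖R.state U‖ ^ 2 ∂(sampleLaw G a b d)) ^ 2

end RTN

/-- The classical Ising partition function on the internal edges with couplings `J`, divided by the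
contribution `N = exp (∑ J e)` of a configuration of equal spins. -/
def isingZ (G : TNGraph V E X) (J : E → ℝ) : ℝ :=
  (Real.exp (∑ e, J e))⁻¹ *
    ∑ σ : V → ℤˣ, Real.exp (∑ e, J e * (((G.ends e).map fun i => (((σ i : ℤ)) : ℝ)).mul))

end Network

/-- An unentangled state vector of `⨂_i ℂ^(κ i)`: a tensor product of unit vectors. -/
def IsProductState {ι : Type*} [Fintype ι] [DecidableEq ι] {κ : ι → Type*} [∀ i, Fintype (κ i)]
    (Ψ : EuclideanSpace ℂ (∀ i, κ i)) : Prop :=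
  ∃ v : ∀ i, EuclideanSpace ℂ (κ i), (∀ i, ‖v i‖ = 1) ∧ ∀ s, Ψ s = ∏ i, v i (s i)

end

set_option linter.unusedSectionVars false

/-! ### Second and fourth moments of a Haar-random unit vector. -/

section HaarMoments

variable {κ : Type*} [Fintype κ] [DecidableEq κ]

/-! The theorem follows from an exact formula, `RTN.invEffDim_eq`: with q_i the total dimension of
the tensor at vertex i, the inverse effective dimension equals (Z / a^n) ∏ q_i/(q_i + 1). Since q_i
is a positive constant times d_i and x/(x + 1) increases strictly to 1, monotonicity and the limit
are immediate.

The formula rests on the moments of a Haar-random unit vector in dimension q. The second moments are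
δ/q. The fourth moments (`haarMoment_eq`) are 1/(q(q+1)) times the number of pairings of the two
plain indices with the two conjugated ones. Only left invariance under two explicit families of
unitaries is used: diagonal phases kill the unpaired moments, and a two-coordinate reflection
determines the others up to one constant, which the unit norm fixes.

The two pairings at each vertex are read as the two values of an Ising spin. Once the fourth moment
of the overlap is expanded, each spin configuration contributes a product over legs. A leg projected
onto a unit vector gives 1 whatever the spin, which is where unentangled `Φ` and `φ` are needed. An
internal edge gives b² for equal spins and b for opposite ones, which is the Boltzmann weight with J
= log √b. The result is Z times (∏ b_e)² / ∏ q_i(q_i+1), and division by the squared mean norm, (a^n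
∏ b_e / ∏ q_i)², leaves the stated formula. -/

instance unitaryHaar_isProbabilityMeasure : IsProbabilityMeasure (unitaryHaar κ) :=
  ⟨by simpa [unitaryHaar] using
    Measure.haarMeasure_self (K₀ := (⊤ : TopologicalSpace.PositiveCompacts
      (Matrix.unitaryGroup κ ℂ)))⟩

instance unitaryHaar_isMulLeftInvariant : (unitaryHaar κ).IsMulLeftInvariant := by
  unfold unitaryHaar; infer_instance

/-- The random vector `U v`. -/
noncomputable def haarVec (v : κ → ℂ) (U : Matrix.unitaryGroup κ ℂ) : κ → ℂ :=
  (U : Matrix κ κ ℂ).mulVec v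

lemma continuous_haarVec (v : κ → ℂ) (α : κ) : Continuous fun U => haarVec v U α := by
  have h : Continuous fun U : Matrix.unitaryGroup κ ℂ => (U : Matrix κ κ ℂ).mulVec v :=
    Continuous.matrix_mulVec continuous_subtype_val continuous_const
  exact (continuous_apply α).comp h

lemma integrable_unitaryHaar_of_continuous {F : Matrix.unitaryGroup κ ℂ → ℂ}
    (hF : Continuous F) : Integrable F (unitaryHaar κ) :=
  hF.integrable_of_hasCompactSupport (HasCompactSupport.of_compactSpace F)

lemma haarVec_mul (v : κ → ℂ) (W U : Matrix.unitaryGroup κ ℂ) :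
    haarVec v (W * U) = (W : Matrix κ κ ℂ).mulVec (haarVec v U) := by
  simp [haarVec, Matrix.mulVec_mulVec]

lemma sum_haarVec_mul_conj {v : κ → ℂ} (hv : ∑ α, v α * star (v α) = 1)
    (U : Matrix.unitaryGroup κ ℂ) : ∑ α, haarVec v U α * star (haarVec v U α) = 1 := by
  have h : star (U : Matrix κ κ ℂ) * (U : Matrix κ κ ℂ) = 1 :=
    Matrix.mem_unitaryGroup_iff'.mp U.2
  have h2 : haarVec v U ⬝ᵥ star (haarVec v U) = v ⬝ᵥ star v := by
    rw [haarVec, Matrix.star_mulVec, dotProduct_comm, Matrix.dotProduct_mulVec,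
      Matrix.vecMul_vecMul, ← Matrix.star_eq_conjTranspose, h, Matrix.vecMul_one,
      dotProduct_comm]
  simpa [dotProduct] using h2.trans hv

/-- A product of two coordinates and two conjugated coordinates of a vector. -/
def quartic (f : κ → ℂ) (α : Fin 4 → κ) : ℂ :=
  f (α 0) * f (α 1) * star (f (α 2)) * star (f (α 3))

lemma continuous_quartic_haarVec (v : κ → ℂ) (α : Fin 4 → κ) :
    Continuous fun U => quartic (haarVec v U) α := by
  have := continuous_haarVec v
  unfold quartic
  fun_prop

/-- The fourth moments of the coordinates of `U v`. -/
noncomputable def haarMoment (v : κ → ℂ) (α : Fin 4 → κ) : ℂ :=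
  ∫ U, quartic (haarVec v U) α ∂(unitaryHaar κ)

lemma haarMoment_eq_mulVec (v : κ → ℂ) (α : Fin 4 → κ) (W : Matrix.unitaryGroup κ ℂ) :
    haarMoment v α =
      ∫ U, quartic ((W : Matrix κ κ ℂ).mulVec (haarVec v U)) α ∂(unitaryHaar κ) := by
  rw [haarMoment, ← integral_mul_left_eq_self _ W]
  simp only [haarVec_mul]

/-- The diagonal unitary multiplying the coordinate `x` by the imaginary unit. -/
noncomputable def phaseUnitary (x : κ) : Matrix.unitaryGroup κ ℂ :=
  ⟨Matrix.diagonal fun y => if y = x then Complex.I else 1, by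
    rw [Matrix.mem_unitaryGroup_iff, Matrix.star_eq_conjTranspose, Matrix.diagonal_conjTranspose,
      Matrix.diagonal_mul_diagonal, ← Matrix.diagonal_one]
    congr 1
    ext y
    by_cases h : y = x <;> simp [h]⟩

lemma haarMoment_phase (v : κ → ℂ) (α : Fin 4 → κ) (x : κ) :
    haarMoment v α = quartic (fun y => if y = x then Complex.I else 1) α * haarMoment v α := by
  conv_lhs => rw [haarMoment_eq_mulVec v α (phaseUnitary x)]
  rw [haarMoment, ← integral_const_mul]
  congr 1
  ext U
  simp only [quartic, phaseUnitary, Matrix.mulVec_diagonal, star_mul]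
  ring

/-- Multiplying coordinate x by `Complex.I` scales the moment by i to the power (occurrences of x
among the plain indices minus those among the conjugated ones). This difference lies between -2 and
2, so the factor is 1 only when it is 0; a sign -1 would miss a difference of 2. In an unpaired
quadruple some coordinate has nonzero difference. -/
lemma haarMoment_eq_zero (v : κ → ℂ) (α : Fin 4 → κ)
    (h : ¬ ((α 0 = α 2 ∧ α 1 = α 3) ∨ (α 0 = α 3 ∧ α 1 = α 2))) : haarMoment v α = 0 := by
  have key : ∀ x, quartic (fun y => if y = x then Complex.I else 1) α ≠ 1 →
      haarMoment v α = 0 := fun x hx => by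
    have h1 := haarMoment_phase v α x
    by_contra h0
    exact hx (mul_right_cancel₀ h0 (by rw [one_mul]; exact h1.symm))
  have e1 : Complex.I ≠ 1 := fun h => by simpa using congrArg Complex.re h
  have e2 : -Complex.I ≠ 1 := fun h => by simpa using congrArg Complex.re h
  have e3 : (-1 : ℂ) ≠ 1 := by norm_num
  by_cases h02 : α 0 = α 2
  · have h13 : α 1 ≠ α 3 := fun h' => h (Or.inl ⟨h02, h'⟩)
    refine key (α 1) ?_
    by_cases h12 : α 1 = α 2 <;>
    simp_all [quartic, eq_comm]
  · by_cases h03 : α 0 = α 3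
    · have h12 : α 1 ≠ α 2 := fun h' => h (Or.inr ⟨h03, h'⟩)
      refine key (α 1) ?_
      by_cases h13 : α 1 = α 3 <;>
      simp_all [quartic, eq_comm]
    · refine key (α 0) ?_
      by_cases h01 : α 0 = α 1 <;>
      simp_all [quartic, eq_comm]

/-- The vector `e_α + 2 e_β`. -/
def reflVec (α β : κ) : κ → ℂ := Pi.single α 1 + Pi.single β 2

lemma reflVec_dotProduct {α β : κ} (f : κ → ℂ) :
    reflVec α β ⬝ᵥ f = f α + 2 * f β := by
  simp [reflVec, add_dotProduct]

lemma star_reflVec (α β : κ) : star (reflVec α β) = reflVec α β := by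
  ext y
  simp only [reflVec, Pi.star_apply, Pi.add_apply, Pi.single_apply]
  split_ifs <;> simp

/-- The reflection along `e_α + 2 e_β`. -/
noncomputable def reflUnitary {α β : κ} (h : α ≠ β) : Matrix.unitaryGroup κ ℂ :=
  ⟨1 - (2 / 5 : ℂ) • Matrix.vecMulVec (reflVec α β) (reflVec α β), by
    -- The squared length 5 makes 2/5 the coefficient of an orthogonal reflection. On the
    -- coordinates α, β its entries are the rationals ±3/5, ±4/5.
    have h5 : reflVec α β ⬝ᵥ reflVec α β = 5 := by
      rw [reflVec_dotProduct]
      simp [reflVec, h, h.symm]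
      norm_num
    have hs : star (2 / 5 : ℂ) = 2 / 5 := by simp
    rw [Matrix.mem_unitaryGroup_iff, star_sub, star_one, star_smul, hs,
      Matrix.star_eq_conjTranspose, Matrix.conjTranspose_vecMulVec, star_reflVec,
      sub_mul, mul_sub, mul_sub, one_mul, mul_one, one_mul, smul_mul_smul_comm,
      Matrix.vecMulVec_mul_vecMulVec, h5]
    ext x y
    simp [Matrix.vecMulVec_apply]
    ring⟩

lemma reflUnitary_mulVec {α β : κ} (h : α ≠ β) (f : κ → ℂ) (x : κ) :
    (reflUnitary h : Matrix κ κ ℂ).mulVec f x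
      = f x - 2 / 5 * (reflVec α β x * (f α + 2 * f β)) := by
  simp only [reflUnitary, Matrix.sub_mulVec, Matrix.one_mulVec, Matrix.smul_mulVec,
    Matrix.vecMulVec_mulVec, reflVec_dotProduct]
  simp

/-- Of the 16 terms in the expansion, those with an odd number of α's vanish, and so do ααββ and
ββαα. The four remaining mixed terms all equal the mean of |f α|²|f β|², hence the factor 4. -/
lemma haarMoment_comb (v : κ → ℂ) {α β : κ} (h : α ≠ β) (x : κ) (c s : ℂ)
    (hc : star c = c) (hs : star s = s)
    (hx : ∀ f : κ → ℂ, (reflUnitary h : Matrix κ κ ℂ).mulVec f x = c * f α + s * f β) :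
    haarMoment v (fun _ => x) =
      c ^ 4 * haarMoment v (fun _ => α) + s ^ 4 * haarMoment v (fun _ => β)
        + 4 * c ^ 2 * s ^ 2 * haarMoment v ![α, β, α, β] := by
  have hz : ∀ a : Fin 4 → κ, ¬ ((a 0 = a 2 ∧ a 1 = a 3) ∨ (a 0 = a 3 ∧ a 1 = a 2)) →
      haarMoment v a = 0 := haarMoment_eq_zero v
  have hi : ∀ (r : ℂ) (a : Fin 4 → κ),
      Integrable (fun U => r * quartic (haarVec v U) a) (unitaryHaar κ) := fun r a =>
    (integrable_unitaryHaar_of_continuous (continuous_quartic_haarVec v a)).const_mul r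
  let y : Fin 2 → κ := ![α, β]
  let w : Fin 2 → ℂ := ![c, s]
  have hq : ∀ f : κ → ℂ, quartic ((reflUnitary h : Matrix κ κ ℂ).mulVec f) (fun _ => x)
      = ∑ i : Fin 2, ∑ j : Fin 2, ∑ k : Fin 2, ∑ l : Fin 2,
        w i * w j * w k * w l * quartic f ![y i, y j, y k, y l] := by
    intro f
    simp only [quartic, hx, Fin.sum_univ_two, w, y, star_add, star_mul, hc, hs]
    simp
    ring
  have hint : haarMoment v (fun _ => x) = ∑ i : Fin 2, ∑ j : Fin 2, ∑ k : Fin 2, ∑ l : Fin 2,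
        w i * w j * w k * w l * haarMoment v ![y i, y j, y k, y l] := by
    rw [haarMoment_eq_mulVec v _ (reflUnitary h)]
    simp only [hq]
    rw [integral_finsetSum _ fun i _ => integrable_finsetSum _ fun j _ =>
      integrable_finsetSum _ fun k _ => integrable_finsetSum _ fun l _ => hi _ _]
    refine Finset.sum_congr rfl fun i _ => ?_
    rw [integral_finsetSum _ fun j _ =>
      integrable_finsetSum _ fun k _ => integrable_finsetSum _ fun l _ => hi _ _]
    refine Finset.sum_congr rfl fun j _ => ?_
    rw [integral_finsetSum _ fun k _ => integrable_finsetSum _ fun l _ => hi _ _]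
    refine Finset.sum_congr rfl fun k _ => ?_
    rw [integral_finsetSum _ fun l _ => hi _ _]
    refine Finset.sum_congr rfl fun l _ => ?_
    rw [integral_const_mul, haarMoment]
  have p1 : haarMoment v ![α, β, β, α] = haarMoment v ![α, β, α, β] := by
    simp only [haarMoment, quartic]; congr 1; ext U; simp; ring
  have p2 : haarMoment v ![β, α, α, β] = haarMoment v ![α, β, α, β] := by
    simp only [haarMoment, quartic]; congr 1; ext U
    simp [mul_comm (haarVec v U β) (haarVec v U α)]
  have p3 : haarMoment v ![β, α, β, α] = haarMoment v ![α, β, α, β] := by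
    simp only [haarMoment, quartic]; congr 1; ext U; simp; ring
  have cα : (fun _ => α : Fin 4 → κ) = ![α, α, α, α] := by ext i; fin_cases i <;> rfl
  have cβ : (fun _ => β : Fin 4 → κ) = ![β, β, β, β] := by ext i; fin_cases i <;> rfl
  have h' := h.symm
  rw [hint, cα, cβ]
  simp only [Fin.sum_univ_two, w, y, Matrix.cons_val_zero, Matrix.cons_val_one]
  rw [hz ![α, α, α, β] (by simp [h]), hz ![α, α, β, α] (by simp [h]),
    hz ![α, β, α, α] (by simp [h']), hz ![β, α, α, α] (by simp [h']),
    hz ![β, β, β, α] (by simp [h']), hz ![β, β, α, β] (by simp [h']),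
    hz ![β, α, β, β] (by simp [h]), hz ![α, β, β, β] (by simp [h]),
    hz ![α, α, β, β] (by simp [h]), hz ![β, β, α, α] (by simp [h']), p1, p2, p3]
  ring

lemma haarMoment_offDiag (v : κ → ℂ) {α β : κ} (h : α ≠ β) :
    haarMoment v (fun _ => β) = haarMoment v (fun _ => α) ∧
      haarMoment v (fun _ => α) = 2 * haarMoment v ![α, β, α, β] := by
  have h1 := haarMoment_comb v h α (3 / 5) (-4 / 5) (by simp) (by simp) fun f => by
    rw [reflUnitary_mulVec]; simp [reflVec, h]; ring
  have h2 := haarMoment_comb v h β (-4 / 5) (-3 / 5) (by simp) (by simp) fun f => by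
    rw [reflUnitary_mulVec]; simp [reflVec, h.symm]; ring
  refine ⟨?_, ?_⟩
  -- With m_α, m_β the diagonal moments and M the mixed one, `h1` and `h2` have coefficients 81/625,
  -- 256/625 (interchanged between the two) and 576/625 for M. Their difference gives (32/25)(m_β -
  -- m_α) = 0; then either one reads 288 m = 576 M.
  · linear_combination (25 / 32 : ℂ) * (h2 - h1)
  · linear_combination (625 / 288 : ℂ) * h1 + (256 / 288) * (25 / 32 : ℂ) * (h2 - h1)

/-- The number of ways of pairing the first two indices with the last two. -/
def pairings (α : Fin 4 → κ) : ℂ :=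
  (if α 0 = α 2 ∧ α 1 = α 3 then 1 else 0) + (if α 0 = α 3 ∧ α 1 = α 2 then 1 else 0)

lemma haarMoment_eq_mul_pairings (v : κ → ℂ) (x : κ) (α : Fin 4 → κ) :
    haarMoment v α = haarMoment v (fun _ => x) / 2 * pairings α := by
  have hd : ∀ y, haarMoment v (fun _ => y) = haarMoment v (fun _ => x) := fun y => by
    by_cases hy : x = y
    · rw [hy]
    · exact (haarMoment_offDiag v hy).1
  by_cases h : (α 0 = α 2 ∧ α 1 = α 3) ∨ (α 0 = α 3 ∧ α 1 = α 2)
  · by_cases h01 : α 0 = α 1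
    · have hα : α = fun _ => α 0 := by
        ext i
        fin_cases i
        · rfl
        · exact h01.symm
        · rcases h with h | h
          · exact h.1.symm
          · exact h.2.symm.trans h01.symm
        · rcases h with h | h
          · exact h.2.symm.trans h01.symm
          · exact h.1.symm
      rw [hα, hd (α 0), pairings]
      simp
      ring
    · have ho := (haarMoment_offDiag v h01).2
      rw [hd (α 0)] at ho
      have hM : haarMoment v α = haarMoment v ![α 0, α 1, α 0, α 1] := by
        rcases h with h | h
        · simp only [haarMoment, quartic]; congr 1; ext U; simp [h.1, h.2]
        · simp only [haarMoment, quartic]; congr 1; ext U; simp [h.1, h.2]; ring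
      have hP : pairings α = 1 := by
        rcases h with h | h
        · simp only [pairings]
          rw [if_pos h, if_neg fun h' => h01 (h.2.trans h'.1.symm).symm, add_zero]
        · simp only [pairings]
          rw [if_pos h, if_neg fun h' => h01 (h.2.trans h'.1.symm).symm, zero_add]
      rw [hM, hP, ho]
      ring
  · rw [haarMoment_eq_zero v α h, pairings, if_neg fun h' => h (Or.inl h'),
      if_neg fun h' => h (Or.inr h')]
    simp

/-- Summing out one plain index against one conjugated index costs nothing because `U v` has norm 1.
This both normalizes the fourth moments and yields the second moments from them. -/
lemma sum_haarMoment {v : κ → ℂ} (hv : ∑ α, v α * star (v α) = 1) (α γ : κ) :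
    ∑ β, haarMoment v ![α, β, γ, β]
      = ∫ U, haarVec v U α * star (haarVec v U γ) ∂(unitaryHaar κ) := by
  simp only [haarMoment]
  rw [← integral_finsetSum _ fun β _ =>
    integrable_unitaryHaar_of_continuous (continuous_quartic_haarVec v _)]
  congr 1
  ext U
  rw [← mul_one (haarVec v U α * star (haarVec v U γ)), ← sum_haarVec_mul_conj hv U,
    Finset.mul_sum]
  refine Finset.sum_congr rfl fun β _ => ?_
  simp [quartic]
  ring

lemma sum_pairings (α γ : κ) :
    ∑ β, pairings ![α, β, γ, β] = if α = γ then (Fintype.card κ : ℂ) + 1 else 0 := by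
  by_cases h : α = γ
  · simp [pairings, h, Finset.sum_add_distrib, eq_comm]
  · have : ∀ β, ¬ (α = β ∧ β = γ) := fun β hβ => h (hβ.1.trans hβ.2)
    simp [pairings, h, this]

/-- Contracting both index pairs gives total mass 1, while the pairings add up to q(q+1). -/
lemma haarMoment_diag [Nonempty κ] {v : κ → ℂ} (hv : ∑ α, v α * star (v α) = 1) (x : κ) :
    haarMoment v (fun _ => x) / 2
      = ((Fintype.card κ : ℂ) * ((Fintype.card κ : ℂ) + 1))⁻¹ := by
  have h1 : ∑ α, ∑ β, haarMoment v ![α, β, α, β] = 1 := by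
    simp only [sum_haarMoment hv]
    rw [← integral_finsetSum _ fun α _ => integrable_unitaryHaar_of_continuous
      (by have := continuous_haarVec v; fun_prop)]
    simp only [sum_haarVec_mul_conj hv]
    simp
  obtain ⟨c, hc⟩ : ∃ c, c = haarMoment v (fun _ => x) / 2 := ⟨_, rfl⟩
  have h2 : ∀ α, haarMoment v α = c * pairings α := fun α => by
    rw [hc, ← haarMoment_eq_mul_pairings]
  simp only [h2, ← Finset.mul_sum, sum_pairings] at h1
  simp only [if_true, Finset.sum_const, Finset.card_univ, nsmul_eq_mul] at h1
  rw [← hc]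
  refine eq_inv_of_mul_eq_one_left ?_
  linear_combination h1

theorem haarMoment_eq [Nonempty κ] {v : κ → ℂ} (hv : ∑ α, v α * star (v α) = 1)
    (α : Fin 4 → κ) :
    haarMoment v α = ((Fintype.card κ : ℂ) * ((Fintype.card κ : ℂ) + 1))⁻¹ * pairings α := by
  rw [haarMoment_eq_mul_pairings v (α 0), haarMoment_diag hv]

theorem integral_haarVec_mul_conj [Nonempty κ] {v : κ → ℂ}
    (hv : ∑ α, v α * star (v α) = 1) (α γ : κ) :
    ∫ U, haarVec v U α * star (haarVec v U γ) ∂(unitaryHaar κ)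
      = (Fintype.card κ : ℂ)⁻¹ * if α = γ then 1 else 0 := by
  rw [← sum_haarMoment hv]
  simp only [haarMoment_eq hv, ← Finset.mul_sum, sum_pairings]
  have : (Fintype.card κ : ℂ) + 1 ≠ 0 := by
    exact_mod_cast Nat.succ_ne_zero (Fintype.card κ)
  split_ifs
  · field_simp
  · simp

end HaarMoments

/-! ### Sums over quadruples of indices, leg by leg. -/

section QuarticSums

variable {κ : Type*}

lemma prod_fin_four_star (g : κ → ℂ) (q : Fin 4 → κ) :
    quartic g q = ∏ k, (![g, g, star g, star g] : Fin 4 → κ → ℂ) k (q k) := by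
  simp [quartic, Fin.prod_univ_four]

lemma sum_quartic [Fintype κ] (g : κ → ℂ) :
    ∑ q, quartic g q = ((‖∑ p, g p‖ ^ 4 : ℝ) : ℂ) := by
  classical
  have h : (((‖∑ p, g p‖ ^ 4 : ℝ)) : ℂ)
      = (∑ p, g p) * (∑ p, g p) * star (∑ p, g p) * star (∑ p, g p) := by
    have h2 : (∑ p, g p) * star (∑ p, g p) = (‖∑ p, g p‖ : ℂ) ^ 2 := Complex.mul_conj' _
    rw [Complex.ofReal_pow]
    linear_combination
      -((‖∑ p, g p‖ : ℂ) ^ 2 + (∑ p, g p) * star (∑ p, g p)) * h2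
  rw [h]
  simp only [prod_fin_four_star]
  rw [← Fintype.piFinset_univ, ← Finset.prod_univ_sum, Fin.prod_univ_four]
  simp

lemma quartic_mul (f g : κ → ℂ) (q : Fin 4 → κ) :
    quartic (fun p => f p * g p) q = quartic f q * quartic g q := by
  simp [quartic]; ring

lemma quartic_prod {ι : Type*} [Fintype ι] (f : ι → κ → ℂ) (q : Fin 4 → κ) :
    quartic (fun p => ∏ i, f i p) q = ∏ i, quartic (f i) q := by
  simp [quartic, Finset.prod_mul_distrib]

/-- The four indices agree in pairs, in the way selected by the spin `ε`. -/
def paired (ε : ℤˣ) (α : Fin 4 → κ) : Prop :=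
  if ε = 1 then α 0 = α 2 ∧ α 1 = α 3 else α 0 = α 3 ∧ α 1 = α 2

open Classical in
lemma pairings_eq_sum_paired [DecidableEq κ] (α : Fin 4 → κ) :
    pairings α = ∑ ε : ℤˣ, if paired ε α then (1 : ℂ) else 0 := by
  have : (Finset.univ : Finset ℤˣ) = {1, -1} := rfl
  rw [this, Finset.sum_pair (by decide)]
  simp [pairings, paired]

lemma sum_fin_four [Fintype κ] {M : Type*} [AddCommMonoid M] (F : (Fin 4 → κ) → M) :
    ∑ q, F q = ∑ x, ∑ y, ∑ z, ∑ w, F ![x, y, z, w] := by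
  let e : (κ × κ × κ × κ) ≃ (Fin 4 → κ) :=
    { toFun := fun p => ![p.1, p.2.1, p.2.2.1, p.2.2.2]
      invFun := fun q => (q 0, q 1, q 2, q 3)
      left_inv := fun p => rfl
      right_inv := fun q => by ext i; fin_cases i <;> rfl }
  rw [← e.sum_comp]
  simp only [Fintype.sum_prod_type]
  rfl

open Classical in
-- Either pairing turns the sum into (∑ |v α|²)². A leg projected onto a unit vector is therefore
-- blind to the spin of its vertex.
lemma sum_quartic_paired [Fintype κ] {v : κ → ℂ} (hv : ∑ α, v α * star (v α) = 1) (ε : ℤˣ) :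
    ∑ q, quartic v q * (if paired ε q then (1 : ℂ) else 0) = 1 := by
  have h2 : (∑ x, v x * star (v x)) * (∑ y, v y * star (v y)) = 1 := by rw [hv, one_mul]
  rw [Finset.sum_mul_sum] at h2
  rw [sum_fin_four]
  refine Eq.trans ?_ h2
  refine Finset.sum_congr rfl fun x _ => Finset.sum_congr rfl fun y _ => ?_
  rcases Int.units_eq_one_or ε with rfl | rfl
  · simp [paired, quartic, ite_and]
    ring
  · have : (-1 : ℤˣ) ≠ 1 := by decide
    simp [paired, quartic, ite_and, this]
    ring

open Classical in
/-- The sum over the four indices of an internal edge whose end points carry the spins `ε` and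
`δ`. -/
lemma sum_paired_paired [Fintype κ] (ε δ : ℤˣ) :
    ∑ q : Fin 4 → κ, (if paired ε q ∧ paired δ q then (1 : ℂ) else 0)
      = if ε = δ then (Fintype.card κ : ℂ) ^ 2 else Fintype.card κ := by
  have hne : (-1 : ℤˣ) ≠ 1 := by decide
  have hne' : (1 : ℤˣ) ≠ -1 := by decide
  rw [sum_fin_four]
  rcases Int.units_eq_one_or ε with rfl | rfl <;> rcases Int.units_eq_one_or δ with rfl | rfl <;>
  simp [paired, ite_and, hne, hne', sq]

/-- Four assignments of basis vectors to the legs are the same as one quadruple for each leg, so the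
sum factors over legs. -/
lemma sum_prod_pi {ι : Type*} [Fintype ι] [DecidableEq ι] {τ : ι → Type*} [∀ i, Fintype (τ i)]
    (h : ∀ i, (Fin 4 → τ i) → ℂ) :
    ∑ q : Fin 4 → ∀ i, τ i, ∏ i, h i (fun k => q k i) = ∏ i, ∑ j, h i j := by
  classical
  rw [Finset.prod_univ_sum, Fintype.piFinset_univ,
    ← (Equiv.piComm (fun (_ : Fin 4) (i : ι) => τ i)).sum_comp]
  rfl

lemma sum_fin_four_prod {S T : Type*} [Fintype S] [Fintype T] (F : (Fin 4 → S) → ℂ)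
    (H : (Fin 4 → T) → ℂ) :
    ∑ q : Fin 4 → S × T, F (fun k => (q k).1) * H (fun k => (q k).2)
      = (∑ s, F s) * ∑ t, H t := by
  rw [Finset.sum_mul_sum, ← Fintype.sum_prod_type',
    ← (Equiv.arrowProdEquivProdArrow (Fin 4) (fun _ => S) (fun _ => T)).sum_comp]
  rfl

lemma sum_mul_star_eq_one [Fintype κ] {v : EuclideanSpace ℂ κ} (h : ‖v‖ = 1) :
    ∑ α, v α * star (v α) = 1 := by
  have h2 : ‖v‖ ^ 2 = 1 := by rw [h, one_pow]
  rw [EuclideanSpace.norm_sq_eq] at h2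
  have h3 := congrArg (fun r : ℝ => (r : ℂ)) h2
  push_cast at h3
  rw [← h3]
  exact Finset.sum_congr rfl fun α _ => Complex.mul_conj' (v α)

end QuarticSums

/-! ### Moments of the network state. -/

section Network

variable {V E X : Type*} [Fintype V] [Fintype E] [Fintype X]
  [DecidableEq V] [DecidableEq E] [DecidableEq X]
variable {G : TNGraph V E X} {a : ℕ} {b : E → ℕ} {d : V → ℕ}

/-- The basis vectors of the legs at the vertex `i` in an assignment of basis vectors to all
legs. -/
def legsAt (G : TNGraph V E X) (i : V)
    (p : (X → Fin a) × (∀ i, Fin (d i)) × (∀ e, Fin (b e))) : LegIndex G a b d i :=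
  (fun x => p.1 x, p.2.1 i, fun e => p.2.2 e)

lemma nonempty_legIndex (ha : 0 < a) (hb : ∀ e, 0 < b e) (hd : ∀ i, 0 < d i) (i : V) :
    Nonempty (LegIndex G a b d i) :=
  ⟨(fun _ => ⟨0, ha⟩, ⟨0, hd i⟩, fun e => ⟨0, hb e⟩)⟩

lemma legsAt_injective (s : X → Fin a)
    {p p' : (∀ i, Fin (d i)) × (∀ e, Fin (b e))}
    (h : ∀ i, legsAt G i (s, p) = legsAt G i (s, p')) : p = p' := by
  refine Prod.ext (funext fun i => congrArg (fun l => l.2.1) (h i)) (funext fun e => ?_)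
  -- Either end point of the edge sees its bond index, so one of them suffices.
  have hm : (Quot.out (G.ends e)).1 ∈ G.ends e := Sym2.out_fst_mem _
  exact congrFun (congrArg (fun l => l.2.2) (h _)) ⟨e, hm⟩

namespace RTN

variable (R : RTN G a b d)

lemma tensor_eq_haarVec (U : UnitarySample G a b d) (i : V) :
    R.tensor U i = haarVec (R.ref i) (U i) := rfl

/-- Distinct labels p differ at some vertex by `hr`, and there the second moment vanishes. The
monomials are thus orthogonal in mean square, all with the same norm. -/
lemma integral_norm_sq_sum {P : Type*} [Fintype P] [DecidableEq P]
    (hq : ∀ i, Nonempty (LegIndex G a b d i)) (r : ∀ i, P → LegIndex G a b d i)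
    (hr : ∀ p p', (∀ i, r i p = r i p') → p = p') (c : P → ℂ) :
    ∫ U, ‖∑ p, c p * ∏ i, R.tensor U i (r i p)‖ ^ 2 ∂(sampleLaw G a b d)
      = (∏ i, (Fintype.card (LegIndex G a b d i) : ℝ)⁻¹) * ∑ p, ‖c p‖ ^ 2 := by
  apply Complex.ofReal_injective
  rw [← integral_complex_ofReal]
  have hpt : ∀ U : UnitarySample G a b d,
      ((‖∑ p, c p * ∏ i, R.tensor U i (r i p)‖ ^ 2 : ℝ) : ℂ)
        = ∑ p, ∑ p', (c p * star (c p')) *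
            ∏ i, haarVec (R.ref i) (U i) (r i p) * star (haarVec (R.ref i) (U i) (r i p')) := by
    intro U
    rw [Complex.ofReal_pow, ← Complex.mul_conj', map_sum, Finset.sum_mul_sum]
    refine Finset.sum_congr rfl fun p _ => Finset.sum_congr rfl fun p' _ => ?_
    simp only [tensor_eq_haarVec, map_mul, map_prod, Finset.prod_mul_distrib, Complex.star_def]
    ring
  have hint : ∀ p p', Integrable (fun U : UnitarySample G a b d => (c p * star (c p')) *
      ∏ i, haarVec (R.ref i) (U i) (r i p) * star (haarVec (R.ref i) (U i) (r i p')))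
      (sampleLaw G a b d) := fun p p' => by
    refine Integrable.const_mul ?_ _
    exact Integrable.fintype_prod_dep
      (f := fun i u => haarVec (R.ref i) u (r i p) * star (haarVec (R.ref i) u (r i p')))
      fun i => integrable_unitaryHaar_of_continuous
        (by have := continuous_haarVec (R.ref i); fun_prop)
  simp only [hpt]
  rw [integral_finsetSum _ fun p _ => integrable_finsetSum _ fun p' _ => hint p p',
    Complex.ofReal_mul, Complex.ofReal_sum, Finset.mul_sum]
  refine Finset.sum_congr rfl fun p _ => ?_
  rw [integral_finsetSum _ fun p' _ => hint p p']
  have hval : ∀ p', ∫ U, (c p * star (c p')) *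
      ∏ i, haarVec (R.ref i) (U i) (r i p) * star (haarVec (R.ref i) (U i) (r i p'))
        ∂(sampleLaw G a b d)
      = if p = p' then (∏ i, (Fintype.card (LegIndex G a b d i) : ℂ)⁻¹) * (c p * star (c p'))
        else 0 := fun p' => by
    rw [integral_const_mul, sampleLaw, integral_fintype_prod_eq_prod
      (f := fun i u => haarVec (R.ref i) u (r i p) * star (haarVec (R.ref i) u (r i p')))]
    simp only [integral_haarVec_mul_conj (sum_mul_star_eq_one (R.norm_ref _)),
      Finset.prod_mul_distrib, Finset.prod_ite_zero, Finset.mem_univ, true_implies,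
      Finset.prod_const_one]
    by_cases h : p = p'
    · simp only [h, implies_true, if_true]
      ring
    · rw [if_neg h, if_neg fun h' => h (hr p p' h')]
      ring
  simp only [hval, Finset.sum_ite_eq, Finset.mem_univ, if_true]
  rw [Complex.star_def, Complex.mul_conj']
  push_cast
  rfl

theorem integral_norm_state_sq (ha : 0 < a) (hb : ∀ e, 0 < b e) (hd : ∀ i, 0 < d i) :
    ∫ U, ‖R.state U‖ ^ 2 ∂(sampleLaw G a b d)
      = (∏ i, (Fintype.card (LegIndex G a b d i) : ℝ)⁻¹) *
          ((a : ℝ) ^ Fintype.card X * ∏ e, (b e : ℝ)) := by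
  have hne := nonempty_legIndex (G := G) ha hb hd
  have hst : ∀ U, ‖R.state U‖ ^ 2 = ∑ s : X → Fin a,
      ‖∑ p : (∀ i, Fin (d i)) × (∀ e, Fin (b e)),
        star (R.bulk p.1) * ∏ i, R.tensor U i (legsAt G i (s, p))‖ ^ 2 := fun U => by
    rw [EuclideanSpace.norm_sq_eq]
    refine Finset.sum_congr rfl fun s _ => ?_
    rw [Fintype.sum_prod_type]
    rfl
  have hbulk : ∑ t, ‖R.bulk t‖ ^ 2 = 1 := by
    rw [← EuclideanSpace.norm_sq_eq, R.norm_bulk, one_pow]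
  have hc : ∑ p : (∀ i, Fin (d i)) × (∀ e, Fin (b e)), ‖star (R.bulk p.1)‖ ^ 2
      = ∏ e, (b e : ℝ) := by
    rw [Fintype.sum_prod_type]
    simp only [norm_star, Finset.sum_const, ← Finset.smul_sum, hbulk]
    simp [Fintype.card_pi]
  have hcont : ∀ s : X → Fin a, Integrable (fun U : UnitarySample G a b d =>
      ‖∑ p : (∀ i, Fin (d i)) × (∀ e, Fin (b e)),
        star (R.bulk p.1) * ∏ i, R.tensor U i (legsAt G i (s, p))‖ ^ 2)
      (sampleLaw G a b d) := fun s => by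
    -- A non-integrable function has Bochner integral 0, but the integral has already been evaluated
    -- and is positive.
    by_contra h
    have h1 := integral_undef h
    rw [integral_norm_sq_sum R hne (fun i p => legsAt G i (s, p))
      (fun p p' h' => legsAt_injective s h'), hc] at h1
    refine absurd h1 (ne_of_gt ?_)
    refine mul_pos (Finset.prod_pos fun i _ => inv_pos.mpr ?_)
      (Finset.prod_pos fun e _ => by exact_mod_cast hb e)
    exact_mod_cast Fintype.card_pos
  simp only [hst]
  rw [integral_finsetSum _ fun s _ => hcont s]
  simp only [integral_norm_sq_sum R hne (fun i p => legsAt G i (_, p))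
      (fun p p' h' => legsAt_injective _ h'), hc]
  simp
  ring

/-- The fourth moment of a linear combination of products of tensor entries. -/
lemma integral_norm_sum_pow_four {P : Type*} [Fintype P]
    (hq : ∀ i, Nonempty (LegIndex G a b d i)) (r : ∀ i, P → LegIndex G a b d i) (c : P → ℂ) :
    ((∫ U, ‖∑ p, c p * ∏ i, R.tensor U i (r i p)‖ ^ 4 ∂(sampleLaw G a b d) : ℝ) : ℂ)
      = (∏ i, ((Fintype.card (LegIndex G a b d i) : ℂ) *
            ((Fintype.card (LegIndex G a b d i) : ℂ) + 1))⁻¹) *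
          ∑ q, quartic c q * ∏ i, pairings fun k => r i (q k) := by
  rw [← integral_complex_ofReal]
  have hpt : ∀ U : UnitarySample G a b d,
      ((‖∑ p, c p * ∏ i, R.tensor U i (r i p)‖ ^ 4 : ℝ) : ℂ)
        = ∑ q, quartic c q *
            ∏ i, quartic (haarVec (R.ref i) (U i)) (fun k => r i (q k)) := fun U => by
    rw [← sum_quartic]
    refine Finset.sum_congr rfl fun q _ => ?_
    rw [quartic_mul, quartic_prod]
    refine congrArg (quartic c q * ·) (Finset.prod_congr rfl fun i _ => ?_)
    simp only [quartic, tensor_eq_haarVec]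
  have hint : ∀ q : Fin 4 → P, Integrable (fun U : UnitarySample G a b d => quartic c q *
      ∏ i, quartic (haarVec (R.ref i) (U i)) (fun k => r i (q k))) (sampleLaw G a b d) :=
      fun q => by
    refine Integrable.const_mul ?_ _
    exact Integrable.fintype_prod_dep
      (f := fun i u => quartic (haarVec (R.ref i) u) (fun k => r i (q k)))
      fun i => integrable_unitaryHaar_of_continuous (continuous_quartic_haarVec _ _)
  simp only [hpt]
  rw [integral_finsetSum _ fun q _ => hint q, Finset.mul_sum]
  refine Finset.sum_congr rfl fun q _ => ?_
  rw [integral_const_mul, sampleLaw, integral_fintype_prod_eq_prod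
    (f := fun i u => quartic (haarVec (R.ref i) u) (fun k => r i (q k)))]
  have hm : ∀ i, ∫ u, quartic (haarVec (R.ref i) u) (fun k => r i (q k))
      ∂(unitaryHaar (LegIndex G a b d i)) = _ := fun i =>
    haarMoment_eq (sum_mul_star_eq_one (R.norm_ref i)) (fun k => r i (q k))
  rw [Finset.prod_congr rfl fun i _ => hm i, Finset.prod_mul_distrib]
  ring

end RTN

/-! ### From pairings to the Ising partition function. -/

open Classical in
/-- The pairings at all vertices as a sum over spin configurations, each of them a product over
the legs. -/
lemma prod_pairings_legsAt (q : Fin 4 → (X → Fin a) × (∀ i, Fin (d i)) × (∀ e, Fin (b e))) :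
    ∏ i, pairings (fun k => legsAt G i (q k)) = ∑ σ : V → ℤˣ,
      (∏ x, if paired (σ (G.site x)) (fun k => (q k).1 x) then (1 : ℂ) else 0) *
      ((∏ i, if paired (σ i) (fun k => (q k).2.1 i) then (1 : ℂ) else 0) *
      (∏ e, if ∀ i ∈ G.ends e, paired (σ i) (fun k => (q k).2.2 e) then (1 : ℂ) else 0)) := by
  simp only [pairings_eq_sum_paired]
  rw [Finset.prod_univ_sum, Fintype.piFinset_univ]
  refine Finset.sum_congr rfl fun σ _ => ?_
  simp only [Finset.prod_ite_zero, Finset.prod_const_one, Finset.mem_univ, true_implies,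
    ite_zero_mul_ite_zero, mul_one]
  refine if_congr ?_ rfl rfl
  have key : ∀ (ε : ℤˣ) (i : V), paired ε (fun k => legsAt G i (q k)) ↔
      (∀ x, G.site x = i → paired ε (fun k => (q k).1 x)) ∧
      paired ε (fun k => (q k).2.1 i) ∧
      (∀ e, i ∈ G.ends e → paired ε (fun k => (q k).2.2 e)) := by
    intro ε i
    simp only [paired, legsAt, Prod.mk.injEq, funext_iff, Subtype.forall]
    split_ifs
    · constructor
      · rintro ⟨⟨h1, h2, h3⟩, h4, h5, h6⟩
        exact ⟨fun x hx => ⟨h1 x hx, h4 x hx⟩, ⟨h2, h5⟩, fun e he => ⟨h3 e he, h6 e he⟩⟩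
      · rintro ⟨h1, ⟨h2, h5⟩, h3⟩
        exact ⟨⟨fun x hx => (h1 x hx).1, h2, fun e he => (h3 e he).1⟩,
          fun x hx => (h1 x hx).2, h5, fun e he => (h3 e he).2⟩
    · constructor
      · rintro ⟨⟨h1, h2, h3⟩, h4, h5, h6⟩
        exact ⟨fun x hx => ⟨h1 x hx, h4 x hx⟩, ⟨h2, h5⟩, fun e he => ⟨h3 e he, h6 e he⟩⟩
      · rintro ⟨h1, ⟨h2, h5⟩, h3⟩
        exact ⟨⟨fun x hx => (h1 x hx).1, h2, fun e he => (h3 e he).1⟩,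
          fun x hx => (h1 x hx).2, h5, fun e he => (h3 e he).2⟩
  constructor
  · intro h
    exact ⟨fun x => ((key _ _).1 (h _)).1 x rfl, fun i => ((key _ _).1 (h i)).2.1,
      fun e i hi => ((key _ _).1 (h i)).2.2 e hi⟩
  · rintro ⟨h1, h2, h3⟩ i
    exact (key _ _).2 ⟨fun x hx => hx ▸ h1 x, h2 i, fun e he => h3 e i he⟩

open Classical in
-- Equal spins impose one pairing, leaving two free indices; opposite spins force all four indices
-- to coincide, leaving one. The coupling log √b is the one that turns this loss of a factor b into
-- exp(-2J).
lemma sum_edge_paired (G : TNGraph V E X) {b : E → ℕ} (hb : ∀ e, 0 < b e) (σ : V → ℤˣ) (e : E) :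
    ∑ q : Fin 4 → Fin (b e), (if ∀ i ∈ G.ends e, paired (σ i) q then (1 : ℂ) else 0)
      = (b e : ℂ) ^ 2 * (Real.exp (Real.log (Real.sqrt (b e)) *
          (((G.ends e).map fun i => (((σ i : ℤ)) : ℝ)).mul - 1)) : ℝ) := by
  have hb' : (0 : ℝ) < b e := by exact_mod_cast hb e
  have hbc : (b e : ℂ) ≠ 0 := by exact_mod_cast (hb e).ne'
  induction h : G.ends e with
  | h i j =>
    have h1 : ∀ q : Fin 4 → Fin (b e), (∀ k ∈ s(i, j), paired (σ k) q) ↔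
        paired (σ i) q ∧ paired (σ j) q := fun q => by simp
    simp only [h1, sum_paired_paired, Fintype.card_fin, Sym2.map_mk, Sym2.mul_mk]
    have h2 : Real.exp (Real.log (Real.sqrt (b e)) * (-1 - 1)) = (b e : ℝ)⁻¹ := by
      rw [Real.log_sqrt hb'.le]
      rw [show Real.log (b e) / 2 * (-1 - 1) = -Real.log (b e) by ring, Real.exp_neg,
        Real.exp_log hb']
    rcases Int.units_eq_one_or (σ i) with hi | hi <;>
    rcases Int.units_eq_one_or (σ j) with hj | hj
    · simp [hi, hj]
    · have : (1 : ℤˣ) ≠ -1 := by decide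
      simp only [hi, hj, if_neg this]
      simp only [Units.val_one, Units.val_neg, Int.cast_neg, Int.cast_one, mul_neg, one_mul]
      rw [h2]
      push_cast
      field_simp
    · have : (-1 : ℤˣ) ≠ 1 := by decide
      simp only [hi, hj, if_neg this]
      simp only [Units.val_one, Units.val_neg, Int.cast_neg, Int.cast_one, mul_one]
      rw [h2]
      push_cast
      field_simp
    · simp [hi, hj]

lemma isingZ_eq_sum (G : TNGraph V E X) (J : E → ℝ) :
    isingZ G J = ∑ σ : V → ℤˣ, ∏ e,
      Real.exp (J e * (((G.ends e).map fun i => (((σ i : ℤ)) : ℝ)).mul - 1)) := by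
  simp only [isingZ, ← Real.exp_neg, Finset.mul_sum, ← Real.exp_add, ← Real.exp_sum]
  refine Finset.sum_congr rfl fun σ _ => ?_
  simp only [mul_sub, mul_one, Finset.sum_sub_distrib]
  congr 1
  ring

lemma isingZ_pos (G : TNGraph V E X) (J : E → ℝ) : 0 < isingZ G J := by
  rw [isingZ_eq_sum]
  exact Finset.sum_pos (fun σ _ => Finset.prod_pos fun e _ => Real.exp_pos _)
    Finset.univ_nonempty

namespace RTN

variable (R : RTN G a b d)

lemma norm_inner_state (U : UnitarySample G a b d) (φ : BoundarySpace X a) :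
    ‖inner ℂ (R.state U) φ‖ = ‖∑ p : (X → Fin a) × (∀ i, Fin (d i)) × (∀ e, Fin (b e)),
      (star (φ p.1) * star (R.bulk p.2.1)) * ∏ i, R.tensor U i (legsAt G i p)‖ := by
  -- Swapping the arguments preserves the norm and leaves the tensor entries unconjugated, as the
  -- fourth moment formula requires.
  rw [← norm_inner_symm, PiLp.inner_apply]
  congr 1
  simp only [Fintype.sum_prod_type]
  refine Finset.sum_congr rfl fun s _ => ?_
  simp only [state, RCLike.inner_apply, mul_comm, Finset.mul_sum]
  refine Finset.sum_congr rfl fun t _ => Finset.sum_congr rfl fun m _ => ?_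
  simp only [legsAt, Complex.star_def]
  ring

theorem integral_norm_inner_pow_four (ha : 0 < a) (hb : ∀ e, 0 < b e) (hd : ∀ i, 0 < d i)
    {φ : BoundarySpace X a} (hΦ : IsProductState R.bulk) (hφ : IsProductState φ) :
    ∫ U, ‖inner ℂ (R.state U) φ‖ ^ 4 ∂(sampleLaw G a b d)
      = (∏ i, ((Fintype.card (LegIndex G a b d i) : ℝ) *
            ((Fintype.card (LegIndex G a b d i) : ℝ) + 1))⁻¹) *
          ((∏ e, (b e : ℝ)) ^ 2 * isingZ G fun e => Real.log (Real.sqrt (b e))) := by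
  classical
  obtain ⟨v, hv, hvp⟩ := hΦ
  obtain ⟨w, hw, hwp⟩ := hφ
  apply Complex.ofReal_injective
  simp only [norm_inner_state]
  rw [integral_norm_sum_pow_four R (nonempty_legIndex ha hb hd) (legsAt G)]
  rw [Complex.ofReal_mul]
  congr 1
  · push_cast; rfl
  simp only [prod_pairings_legsAt, Finset.mul_sum]
  rw [Finset.sum_comm, isingZ_eq_sum, Finset.mul_sum, Complex.ofReal_sum]
  refine Finset.sum_congr rfl fun σ _ => ?_
  -- The boundary and bulk vectors enter the overlap conjugated, so the leg sums are applied to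
  -- conjugates of unit vectors.
  have hstar : ∀ {n : ℕ} {u : EuclideanSpace ℂ (Fin n)}, ‖u‖ = 1 →
      ∑ α, star (u α) * star (star (u α)) = 1 := fun hu => by
    rw [← sum_mul_star_eq_one hu]
    refine Finset.sum_congr rfl fun α _ => ?_
    rw [star_star, mul_comm]
  have hq : ∀ q : Fin 4 → (X → Fin a) × (∀ i, Fin (d i)) × (∀ e, Fin (b e)),
      quartic (fun p => star (φ p.1) * star (R.bulk p.2.1)) q
        = (∏ x, quartic (fun j => star (w x j)) (fun k => (q k).1 x)) *
          ∏ i, quartic (fun j => star (v i j)) (fun k => (q k).2.1 i) := fun q => by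
    simp only [hvp, hwp, quartic, star_mul', star_prod, star_star, Finset.prod_mul_distrib]
    ring
  -- For fixed σ the sum splits into external, logical and internal legs: `hF` and `hT` evaluate to
  -- 1, and only the internal edges in `hM` retain the spins.
  have hF := sum_prod_pi (ι := X) (τ := fun _ => Fin a) fun x j =>
    quartic (fun j => star (w x j)) j * if paired (σ (G.site x)) j then (1 : ℂ) else 0
  have hT := sum_prod_pi (ι := V) (τ := fun i => Fin (d i)) fun i j =>
    quartic (fun j => star (v i j)) j * if paired (σ i) j then (1 : ℂ) else 0
  have hM := sum_prod_pi (ι := E) (τ := fun e => Fin (b e)) fun e j =>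
    if ∀ i ∈ G.ends e, paired (σ i) j then (1 : ℂ) else 0
  simp only [sum_quartic_paired (hstar (hw _)), Finset.prod_const_one] at hF
  simp only [sum_quartic_paired (hstar (hv _)), Finset.prod_const_one] at hT
  simp only [sum_edge_paired G hb] at hM
  have h1 := sum_fin_four_prod
    (fun s : Fin 4 → X → Fin a => ∏ x, (quartic (fun j => star (w x j)) (fun k => s k x) *
      if paired (σ (G.site x)) (fun k => s k x) then (1 : ℂ) else 0))
    (fun p : Fin 4 → (∀ i, Fin (d i)) × (∀ e, Fin (b e)) =>
      (∏ i, (quartic (fun j => star (v i j)) (fun k => (p k).1 i) *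
        if paired (σ i) (fun k => (p k).1 i) then (1 : ℂ) else 0)) *
      ∏ e, if ∀ i ∈ G.ends e, paired (σ i) (fun k => (p k).2 e) then (1 : ℂ) else 0)
  have h2 := sum_fin_four_prod
    (fun t : Fin 4 → ∀ i, Fin (d i) =>
      ∏ i, (quartic (fun j => star (v i j)) (fun k => t k i) *
        if paired (σ i) (fun k => t k i) then (1 : ℂ) else 0))
    (fun m : Fin 4 → ∀ e, Fin (b e) =>
      ∏ e, if ∀ i ∈ G.ends e, paired (σ i) (fun k => m k e) then (1 : ℂ) else 0)
  rw [h2, hF, hT, hM, one_mul, one_mul] at h1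
  have h3 : ∏ e, ((b e : ℂ) ^ 2 * (Real.exp (Real.log (Real.sqrt (b e)) *
          (((G.ends e).map fun i => (((σ i : ℤ)) : ℝ)).mul - 1)) : ℝ))
      = (((∏ e, (b e : ℝ)) ^ 2 * ∏ e, Real.exp (Real.log (Real.sqrt (b e)) *
          (((G.ends e).map fun i => (((σ i : ℤ)) : ℝ)).mul - 1)) : ℝ) : ℂ) := by
    rw [Finset.prod_mul_distrib, Finset.prod_pow]
    push_cast
    rfl
  rw [← h3, ← h1]
  refine Finset.sum_congr rfl fun q _ => ?_
  simp only [hq, Finset.prod_mul_distrib]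
  ring

/-- The bond dimensions outside Z cancel, and each vertex keeps q²/(q(q+1)) = q/(q+1). -/
theorem invEffDim_eq (ha : 0 < a) (hb : ∀ e, 0 < b e) (hd : ∀ i, 0 < d i)
    {φ : BoundarySpace X a} (hΦ : IsProductState R.bulk) (hφ : IsProductState φ) :
    R.invEffDim φ = (isingZ G fun e => Real.log (Real.sqrt (b e))) / (a : ℝ) ^ Fintype.card X *
      ∏ i, (Fintype.card (LegIndex G a b d i) : ℝ) /
        ((Fintype.card (LegIndex G a b d i) : ℝ) + 1) := by
  have hne := nonempty_legIndex (G := G) ha hb hd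
  rw [invEffDim, integral_norm_inner_pow_four R ha hb hd hΦ hφ,
    integral_norm_state_sq R ha hb hd]
  have hA : (a : ℝ) ^ Fintype.card X ≠ 0 := pow_ne_zero _ (by exact_mod_cast ha.ne')
  have hB : ∏ e, (b e : ℝ) ≠ 0 := Finset.prod_ne_zero_iff.mpr fun e _ => by
    exact_mod_cast (hb e).ne'
  have hQ : ∏ i, (Fintype.card (LegIndex G a b d i) : ℝ) ≠ 0 :=
    Finset.prod_ne_zero_iff.mpr fun i _ => by exact_mod_cast Fintype.card_ne_zero
  have hQ' : ∏ i, ((Fintype.card (LegIndex G a b d i) : ℝ) + 1) ≠ 0 :=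
    Finset.prod_ne_zero_iff.mpr fun i _ => by positivity
  simp only [Finset.prod_inv_distrib, Finset.prod_mul_distrib, Finset.prod_div_distrib]
  field_simp

end RTN

/-! ### Dependence on the logical dimensions. -/

lemma card_legIndex (i : V) : Fintype.card (LegIndex G a b d i)
    = a ^ Fintype.card {x : X // G.site x = i} * d i *
        ∏ e : {e : E // i ∈ G.ends e}, b e := by
  simp [Fintype.card_pi, mul_assoc]

lemma div_add_one_lt {x y : ℝ} (hx : 0 ≤ x) (h : x < y) : x / (x + 1) < y / (y + 1) := by
  rw [div_lt_div_iff₀ (by linarith) (by linarith)]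
  linarith

lemma tendsto_div_add_one : Tendsto (fun x : ℝ => x / (x + 1)) atTop (𝓝 1) := by
  have h1 : Tendsto (fun x : ℝ => 1 - (x + 1)⁻¹) atTop (𝓝 (1 - 0)) :=
    tendsto_const_nhds.sub (tendsto_inv_atTop_zero.comp
      (tendsto_atTop_add_const_right _ _ tendsto_id))
  rw [sub_zero] at h1
  refine h1.congr' ?_
  filter_upwards [eventually_gt_atTop 0] with x hx
  field_simp
  ring

end Network

theorem mainTheorem8 {V E X : Type*} [Fintype V] [Fintype E] [Fintype X]
    [DecidableEq V] [DecidableEq E] [DecidableEq X]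
    (G : TNGraph V E X) (a : ℕ) (ha : 0 < a) (b : E → ℕ) (hb : ∀ e, 0 < b e) :
    -- strict monotonicity in the logical dimension of any single vertex `k`
    (∀ (k : V) (d d' : V → ℕ), (∀ i, 0 < d i) → d k < d' k → (∀ i, i ≠ k → d' i = d i) →
      ∀ (R : RTN G a b d) (R' : RTN G a b d') (φ φ' : BoundarySpace X a),
        IsProductState R.bulk → IsProductState R'.bulk →
        IsProductState φ → IsProductState φ' →
        R.invEffDim φ < R'.invEffDim φ') ∧
    -- limit of large logical dimensions
    (∀ d : ℕ → V → ℕ, (∀ m i, 0 < d m i) → (∀ i, Tendsto (fun m => d m i) atTop atTop) →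
      ∀ (R : ∀ m, RTN G a b (d m)) (φ : ℕ → BoundarySpace X a),
        (∀ m, IsProductState (R m).bulk) → (∀ m, IsProductState (φ m)) →
        Tendsto (fun m => (R m).invEffDim (φ m)) atTop
          (𝓝 (isingZ G (fun e => Real.log (Real.sqrt (b e))) / (a : ℝ) ^ Fintype.card X))) := by
  have hc : ∀ i, 0 < a ^ Fintype.card {x : X // G.site x = i} ∧
      0 < ∏ e : {e : E // i ∈ G.ends e}, b e := fun i =>
    ⟨pow_pos ha _, Finset.prod_pos fun e _ => hb e⟩
  constructor
  · intro k d d' hd hk hne R R' φ φ' hΦ hΦ' hφ hφ'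
    have hd' : ∀ i, 0 < d' i := fun i => by
      by_cases h : i = k
      · rw [h]; exact (hd k).trans hk
      · rw [hne i h]; exact hd i
    rw [R.invEffDim_eq ha hb hd hΦ hφ, R'.invEffDim_eq ha hb hd' hΦ' hφ']
    refine mul_lt_mul_of_pos_left ?_
      (div_pos (isingZ_pos _ _) (pow_pos (by exact_mod_cast ha) _))
    refine Finset.prod_lt_prod (fun i _ => ?_) (fun i _ => ?_) ⟨k, Finset.mem_univ k, ?_⟩
    · have := nonempty_legIndex (G := G) ha hb hd i
      have h : (0 : ℝ) < Fintype.card (LegIndex G a b d i) := by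
        exact_mod_cast Fintype.card_pos
      positivity
    · by_cases h : i = k
      · subst h
        refine (div_add_one_lt (Nat.cast_nonneg _) ?_).le
        rw [Nat.cast_lt, card_legIndex, card_legIndex]
        exact Nat.mul_lt_mul_of_pos_right (Nat.mul_lt_mul_of_pos_left hk (hc i).1) (hc i).2
      · rw [card_legIndex, card_legIndex, hne i h]
    · refine div_add_one_lt (Nat.cast_nonneg _) ?_
      rw [Nat.cast_lt, card_legIndex, card_legIndex]
      exact Nat.mul_lt_mul_of_pos_right (Nat.mul_lt_mul_of_pos_left hk (hc k).1) (hc k).2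
  · intro d hd hlim R φ hΦ hφ
    simp only [fun m => (R m).invEffDim_eq ha hb (hd m) (hΦ m) (hφ m)]
    have h1 : Tendsto (fun m => ∏ i, (Fintype.card (LegIndex G a b (d m) i) : ℝ) /
        ((Fintype.card (LegIndex G a b (d m) i) : ℝ) + 1)) atTop (𝓝 (∏ _i : V, 1)) := by
      refine tendsto_finsetProd _ fun i _ => tendsto_div_add_one.comp ?_
      refine tendsto_natCast_atTop_atTop.comp (tendsto_atTop_mono (fun m => ?_) (hlim i))
      rw [card_legIndex]
      -- The other factors of the tensor dimension are at least 1, so it dominates the logical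
      -- dimension and diverges with it.
      calc d m i = 1 * d m i * 1 := by ring
        _ ≤ _ := Nat.mul_le_mul (Nat.mul_le_mul_right _ (hc i).1) (hc i).2
    rw [Finset.prod_const_one] at h1
    simpa using h1.const_mul
      (isingZ G (fun e => Real.log (Real.sqrt (b e))) / (a : ℝ) ^ Fintype.card X)
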